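/- **Setting.** Let $\Omega\subset\mathbb R^2$ be a bounded domain with Lipschitz boundary, $T>0$, $\varepsilon>0$, $n\ge 1$ an integer and $h:=T/n$. Let the open unit cell $\mathcal Y=(0,1)^2$ be the disjoint union of two measurable sets $\mathcal Y_c$, $\mathcal Y_a$, let $\chi_c,\chi_a$ be their characteristic functions, extended $\mathcal Y$-periodically to $\mathbb R^2$, and put $\chi_c^\varepsilon(x)=\chi_c(x/\varepsilon)$, $\chi_a^\varepsilon(x)=\chi_a(x/\varepsilon)$. Assume: * $\mathcal S\in C^1(\mathbb R)$, $0<\mathcal S(\xi)\le C_s$ and $0<\mathcal S'(\xi)\le S_L$ for all $\xi\in\mathbb R$; * $k_c,\mu:\mathbb R\to\mathbb R$ are continuous with $0<k_1\le k_c\le k_2$ and $0<\mu_1\le\mu\le\mu_2$; $k_R\in C([0,C_s])$ is positive and strictly increasing; * $\phi_c:\mathbb R\to\mathbb R$ is Lipschitz continuous with constant $C_\phi>0$, and $0<\phi_1\le\phi_c\le\phi_2$; * $f:\mathbb R^3\to\mathbb R$ is Lipschitz continuous, $0\le f\le C_f$, and $f(\xi_1,\xi_2,\xi_3)=0$ whenever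 $\xi_1\le p_\infty$; * $\varrho_w>0$, $\phi_a>0$, $k_a>0$, $\beta_e>0$, $\alpha_1<0$, $p_\infty<0$ are constants, and $\alpha_1+\varrho_wC_\phi C_s<0$; * $p_0\in L^\infty(\Omega)$ and $p_\infty<p_0\le 0$ a.e. in $\Omega$. Let $p_n^0=p_0$ and $r_n^0=0$ a.e. in $\Omega$. Let $\vartheta_n^{0},\dots,\vartheta_n^{n-1}\in L^1(\Omega)$ and $r_n^0,\dots,r_n^n\in L^1(\Omega)$ be given, and let $p_n^1,\dots,p_n^n\in W^{1,2}(\Omega)\cap L^\infty(\Omega)$ be such that, for every $i=1,\dots,n$, $$r_n^i=h\sum_{j=1}^i f(p_n^j,\vartheta_n^{j-1},r_n^{j-1})\quad\text{a.e. in }\Omega,$$ and such that $p_n^i$ solves the time-discretized pressure equation $$\begin{aligned} &\varrho_w\int_\Omega\chi_c^\varepsilon\,\frac{\phi_c(r_n^i)\mathcal S(p_n^i)-\phi_c(r_n^{i-1})\mathcal S(p_n^{i-1})}{h}\,\zeta\,dx +\varrho_w\int_\Omega\chi_a^\varepsilon\,\phi_a\,\frac{\mathcal S(p_n^i)-\mathcal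 S(p_n^{i-1})}{h}\,\zeta\,dx\\ &+\varrho_w\int_\Omega\Big[\chi_c^\varepsilon\frac{k_c(r_n^{i-1})}{\mu(\vartheta_n^{i-1})}+\chi_a^\varepsilon\frac{k_a}{\mu(\vartheta_n^{i-1})}\Big]k_R(\mathcal S(p_n^i))\,\nabla p_n^i\cdot\nabla\zeta\,dx +\beta_e\int_{\partial\Omega}(p_n^i-p_\infty)\,\zeta\,dS\\ &=\alpha_1\int_\Omega\chi_c^\varepsilon\,f(p_n^i,\vartheta_n^{i-1},r_n^{i-1})\,\zeta\,dx \qquad\text{for all }\zeta\in W^{1,2}(\Omega), \end{aligned}$$ where the values of $p_n^i$ and $\zeta$ on $\partial\Omega$ are taken in the sense of traces. **Theorem.** For every $i=1,\dots,n$, $$p_\infty\le p_n^i\le 0\quad\text{a.e. in }\Omega,$$ and the trace of $p_n^i$ satisfies $p_\infty\le p_n^i\le 0$ a.e. on $\partial\Omega$ with respect to surface measure. -/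

import Mathlib

open MeasureTheory Filter Topology Set
open scoped ENNReal NNReal ContDiff

noncomputable section

namespace PorousMedium

/-- The Euclidean plane. -/
abbrev Plane : Type := EuclideanSpace ℝ (Fin 2)

/-! ### Bounded Lipschitz domains, Sobolev functions and traces -/

/-- A bounded domain (nonempty, open, connected) of the plane with Lipschitz boundary: near every
boundary point and in suitable Cartesian coordinates, the domain is the region strictly above the
graph of a Lipschitz function. -/
structure IsLipschitzDomain (Ω : Set Plane) : Prop where
  isOpen : IsOpen Ω
  isConnected : IsConnected Ω
  isBounded : Bornology.IsBounded Ω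
  locally_graph : ∀ x₀ ∈ frontier Ω, ∃ (e : Plane ≃ₗᵢ[ℝ] Plane) (γ : ℝ → ℝ) (K : ℝ≥0) (ρ : ℝ),
    LipschitzWith K γ ∧ 0 < ρ ∧ ∀ x ∈ Metric.ball x₀ ρ, x ∈ Ω ↔ γ (e x 0) < e x 1

/-- The surface (arc length) measure on the boundary of `Ω`. -/
def surfaceMeasure (Ω : Set Plane) : Measure Plane :=
  (Measure.hausdorffMeasure 1).restrict (frontier Ω)

/-- `G` is the weak gradient of `u` in `Ω`, tested against smooth functions with compact support
in `Ω`. -/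
def HasWeakGradient (Ω : Set Plane) (u : Plane → ℝ) (G : Plane → Plane) : Prop :=
  ∀ φ : Plane → ℝ, ContDiff ℝ ∞ φ → HasCompactSupport φ → tsupport φ ⊆ Ω → ∀ i : Fin 2,
    ∫ x in Ω, u x * fderiv ℝ φ x (EuclideanSpace.single i 1) = - ∫ x in Ω, G x i * φ x

/-- The Sobolev space `W^{1,2}(Ω)`. -/
def MemW12 (Ω : Set Plane) (u : Plane → ℝ) : Prop :=
  MemLp u 2 (volume.restrict Ω) ∧
    ∃ G : Plane → Plane, MemLp G 2 (volume.restrict Ω) ∧ HasWeakGradient Ω u G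

open Classical in
/-- The weak gradient of a function of `W^{1,2}(Ω)` (unique up to a null set). -/
def weakGradient (Ω : Set Plane) (u : Plane → ℝ) : Plane → Plane :=
  if hu : MemW12 Ω u then hu.2.choose else 0

/-- `g ∈ L²(∂Ω)` is the boundary trace of `u ∈ W^{1,2}(Ω)`: the trace operator is the continuous
extension to `W^{1,2}(Ω)` of the restriction map `v ↦ v|_{∂Ω}` on functions which are `C¹` up to
the boundary. -/
def IsTrace (Ω : Set Plane) (u g : Plane → ℝ) : Prop :=
  MemW12 Ω u ∧ MemLp g 2 (surfaceMeasure Ω) ∧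
    ∃ v : ℕ → Plane → ℝ, (∀ k, ContDiff ℝ 1 (v k)) ∧
      Tendsto (fun k => eLpNorm (fun x => v k x - u x) 2 (volume.restrict Ω)) atTop (𝓝 0) ∧
      Tendsto (fun k => eLpNorm (fun x => gradient (v k) x - weakGradient Ω u x) 2
        (volume.restrict Ω)) atTop (𝓝 0) ∧
      Tendsto (fun k => eLpNorm (fun x => v k x - g x) 2 (surfaceMeasure Ω)) atTop (𝓝 0)

/-! ### The periodic microstructure -/

/-- The open unit cell `(0,1)²`. -/
def unitCell : Set Plane := {y | ∀ i, 0 < y i ∧ y i < 1}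

/-- The characteristic function of a subset `A` of the unit cell, extended periodically to the
plane. -/
def periodicIndicator (A : Set Plane) (y : Plane) : ℝ :=
  A.indicator (fun _ => (1 : ℝ)) (WithLp.toLp 2 fun i => Int.fract (y i))

/-! ### The data of the pressure equation -/

/-- Coefficient functions and constants of the pressure equation. -/
structure PressureData where
  /-- the part of the unit cell occupied by cement paste -/
  Yc : Set Plane
  /-- the part of the unit cell occupied by aggregates -/
  Ya : Set Plane
  /-- degree of saturation -/
  S : ℝ → ℝ
  /-- upper bound of the saturation -/
  Cs : ℝ
  /-- upper bound of the derivative of the saturation -/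
  SL : ℝ
  /-- relative hydraulic conductivity -/
  kR : ℝ → ℝ
  /-- intrinsic permeability of cement paste -/
  kc : ℝ → ℝ
  /-- lower bound of `kc` -/
  k₁ : ℝ
  /-- upper bound of `kc` -/
  k₂ : ℝ
  /-- intrinsic permeability of aggregates -/
  ka : ℝ
  /-- viscosity -/
  mu : ℝ → ℝ
  /-- lower bound of the viscosity -/
  mu₁ : ℝ
  /-- upper bound of the viscosity -/
  mu₂ : ℝ
  /-- porosity of cement paste -/
  phic : ℝ → ℝ
  /-- Lipschitz constant of `phic` -/
  Cphi : ℝ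
  /-- lower bound of `phic` -/
  phi₁ : ℝ
  /-- upper bound of `phic` -/
  phi₂ : ℝ
  /-- porosity of aggregates -/
  phia : ℝ
  /-- hydration rate, as a function of pressure, temperature and memory -/
  f : ℝ → ℝ → ℝ → ℝ
  /-- upper bound of the hydration rate -/
  Cf : ℝ
  /-- density of liquid water -/
  rhow : ℝ
  /-- surface emissivity of water -/
  betae : ℝ
  /-- coefficient of the hydration sink -/
  alpha₁ : ℝ
  /-- ambient water pressure -/
  pinf : ℝ

/-- The structural assumptions on the data of the pressure equation. -/
structure PressureData.Admissible (D : PressureData) : Prop where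
  measurableSet_Yc : MeasurableSet D.Yc
  measurableSet_Ya : MeasurableSet D.Ya
  disjoint_cells : Disjoint D.Yc D.Ya
  union_cells : D.Yc ∪ D.Ya = unitCell
  S_contDiff : ContDiff ℝ 1 D.S
  S_bounds : ∀ ξ, 0 < D.S ξ ∧ D.S ξ ≤ D.Cs
  S_deriv_bounds : ∀ ξ, 0 < deriv D.S ξ ∧ deriv D.S ξ ≤ D.SL
  kR_continuousOn : ContinuousOn D.kR (Icc 0 D.Cs)
  kR_strictMono : ∀ ξ₁ ∈ Icc 0 D.Cs, ∀ ξ₂ ∈ Icc 0 D.Cs, ξ₁ ≠ ξ₂ →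
    0 < (D.kR ξ₁ - D.kR ξ₂) * (ξ₁ - ξ₂)
  kR_pos : ∀ ξ ∈ Icc 0 D.Cs, 0 < D.kR ξ
  kc_continuous : Continuous D.kc
  k₁_pos : 0 < D.k₁
  kc_bounds : ∀ ξ, D.k₁ ≤ D.kc ξ ∧ D.kc ξ ≤ D.k₂
  ka_pos : 0 < D.ka
  mu_continuous : Continuous D.mu
  mu₁_pos : 0 < D.mu₁
  mu_bounds : ∀ ξ, D.mu₁ ≤ D.mu ξ ∧ D.mu ξ ≤ D.mu₂
  Cphi_pos : 0 < D.Cphi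
  phic_lipschitz : ∀ ξ₁ ξ₂, |D.phic ξ₁ - D.phic ξ₂| ≤ D.Cphi * |ξ₁ - ξ₂|
  phi₁_pos : 0 < D.phi₁
  phic_bounds : ∀ ξ, D.phi₁ ≤ D.phic ξ ∧ D.phic ξ ≤ D.phi₂
  phia_pos : 0 < D.phia
  f_lipschitz : ∃ L : ℝ, ∀ ξ₁ ξ₂ ξ₃ η₁ η₂ η₃,
    |D.f ξ₁ ξ₂ ξ₃ - D.f η₁ η₂ η₃| ≤ L * (|ξ₁ - η₁| + |ξ₂ - η₂| + |ξ₃ - η₃|)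
  f_bounds : ∀ ξ₁ ξ₂ ξ₃, 0 ≤ D.f ξ₁ ξ₂ ξ₃ ∧ D.f ξ₁ ξ₂ ξ₃ ≤ D.Cf
  f_eq_zero : ∀ ξ₁ ξ₂ ξ₃, ξ₁ ≤ D.pinf → D.f ξ₁ ξ₂ ξ₃ = 0
  rhow_pos : 0 < D.rhow
  betae_pos : 0 < D.betae
  alpha₁_neg : D.alpha₁ < 0
  pinf_neg : D.pinf < 0
  drying : D.alpha₁ + D.rhow * D.Cphi * D.Cs < 0

/-- The characteristic function of the cement paste at scale `ε`. -/
def PressureData.chic (D : PressureData) (ε : ℝ) (x : Plane) : ℝ :=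
  periodicIndicator D.Yc (ε⁻¹ • x)

/-- The characteristic function of the aggregates at scale `ε`. -/
def PressureData.chia (D : PressureData) (ε : ℝ) (x : Plane) : ℝ :=
  periodicIndicator D.Ya (ε⁻¹ • x)

/-- One step, of length `h`, of the time-discretized pressure equation in weak form. Here `p` is
the new pressure and `q` its boundary trace, `r` is the new memory function, and `pPrev`,
`thPrev`, `rPrev` are the pressure, temperature and memory function at the preceding time level.
The test function `ζ` ranges over `W^{1,2}(Ω)`, and `ζb` is its trace. -/
def PressureData.SolvesStep (D : PressureData) (Ω : Set Plane) (ε h : ℝ)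
    (pPrev thPrev rPrev r p q : Plane → ℝ) : Prop :=
  ∀ ζ ζb : Plane → ℝ, MemW12 Ω ζ → IsTrace Ω ζ ζb →
    D.rhow * (∫ x in Ω, D.chic ε x *
        ((D.phic (r x) * D.S (p x) - D.phic (rPrev x) * D.S (pPrev x)) / h) * ζ x)
    + D.rhow * (∫ x in Ω, D.chia ε x * D.phia * ((D.S (p x) - D.S (pPrev x)) / h) * ζ x)
    + D.rhow * (∫ x in Ω,
        (D.chic ε x * (D.kc (rPrev x) / D.mu (thPrev x)) * D.kR (D.S (p x))
          + D.chia ε x * (D.ka / D.mu (thPrev x)) * D.kR (D.S (p x)))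
        * inner ℝ (weakGradient Ω p x) (weakGradient Ω ζ x))
    + D.betae * (∫ x, (q x - D.pinf) * ζb x ∂(surfaceMeasure Ω))
    = D.alpha₁ * (∫ x in Ω, D.chic ε x * D.f (p x) (thPrev x) (rPrev x) * ζ x)

end PorousMedium

end

/-!
The bounds are proved by induction over the time steps, testing the equation for `p = p i` with
truncations of `p` itself (Stampacchia's method).

For the lower bound the test function is `ζ = min (p - pinf) 0`. Where `ζ ≠ 0` the hydration rate
vanishes, hence the memory function does not change and the zero-order term has the sign of
`S p - S pPrev < 0`; the diffusion and the boundary flux `(q - pinf) ζ = ζ²` are nonnegative against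
`ζ`. For the upper bound the test function is `(p - s)⁺` with `s > 0`. Where it does not vanish, the
saturation has grown, and the loss from the change of porosity, at most `rhow * Cphi * Cs * f`, is
absorbed by the hydration sink because `alpha₁ + rhow * Cphi * Cs < 0`. In both cases a sum of
nonnegative terms is zero, and since `S` is strictly increasing and `betae > 0`, the test function
vanishes almost everywhere in `Ω` and its trace almost everywhere on the boundary
(`PressureData.SolvesStep.ae_eq_zero`); this is `PressureData.SolvesStep.bounds`. Using `s > 0`
instead of `s = 0` keeps the boundary integrand integrable without any appeal to the finiteness of
the surface measure.

The analytic ingredient is that truncations are admissible test functions, with the expected weak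
gradient and trace (`IsTruncation.isTrace`). The functions `C¹` up to the boundary that define the
trace of `p` are composed with `C¹` approximations of the truncation. A diagonal sequence of these
converges in `L²(Ω)`, together with its gradients, and in `L²(∂Ω)`. As `L²` limits of classical
gradients are weak gradients, this one sequence yields membership in `W^{1,2}`, the chain rule and
the trace.
-/

namespace PorousMedium

/-! ### Convergence in `L²` -/

theorem tendsto_eLpNorm_two_zero_of_dominated {α E F : Type*} [MeasurableSpace α]
    {μ : Measure α} [NormedAddCommGroup E] [NormedAddCommGroup F]
    {f : ℕ → α → E} {b : α → F} (hf : ∀ m, AEStronglyMeasurable (f m) μ) (hb : MemLp b 2 μ)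
    (hle : ∀ m, ∀ᵐ x ∂μ, ‖f m x‖ ≤ ‖b x‖)
    (hlim : ∀ᵐ x ∂μ, Tendsto (fun m => f m x) atTop (𝓝 0)) :
    Tendsto (fun m => eLpNorm (f m) 2 μ) atTop (𝓝 0) := by
  have key : Tendsto (fun m => ∫⁻ x, ‖f m x‖ₑ ^ (2 : ℝ) ∂μ) atTop (𝓝 (∫⁻ _, 0 ∂μ)) := by
    refine tendsto_lintegral_of_dominated_convergence' (fun x => ‖b x‖ₑ ^ (2 : ℝ))
      (fun m => (hf m).enorm.pow_const _) (fun m => ?_) ?_ ?_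
    · filter_upwards [hle m] with x hx
      exact ENNReal.rpow_le_rpow (enorm_le_iff_norm_le.2 hx) (by norm_num)
    · have := lintegral_rpow_enorm_lt_top_of_eLpNorm_lt_top (p := 2) (by norm_num) (by norm_num)
        hb.2
      simpa using this.ne
    · filter_upwards [hlim] with x hx
      have h1 := (continuous_enorm.tendsto (0 : E)).comp hx
      have h2 := (ENNReal.continuous_rpow_const (y := (2 : ℝ))).tendsto _ |>.comp h1
      simpa [Function.comp_def] using h2
  have h3 := (ENNReal.continuous_rpow_const (y := (1 / 2 : ℝ))).tendsto _ |>.comp key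
  simp only [eLpNorm_eq_lintegral_rpow_enorm_toReal (μ := μ) (p := 2) (by norm_num) (by norm_num)]
  simpa [Function.comp_def] using h3

theorem tendsto_integral_mul_of_tendsto_eLpNorm_two {α : Type*} [MeasurableSpace α]
    {μ : Measure α} {f : ℕ → α → ℝ} {g φ : α → ℝ} (hf : ∀ m, AEStronglyMeasurable (f m) μ)
    (hg : MemLp g 2 μ) (hφ : MemLp φ 2 μ)
    (h : Tendsto (fun m => eLpNorm (fun x => f m x - g x) 2 μ) atTop (𝓝 0)) :
    Tendsto (fun m => ∫ x, f m x * φ x ∂μ) atTop (𝓝 (∫ x, g x * φ x ∂μ)) := by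
  refine tendsto_integral_of_L1' _ (hg.1.mul hφ.1) ?_ ?_
  · filter_upwards [h.eventually_lt_const (u := 1) (by norm_num)] with m hm
    have h1 : MemLp (fun x => f m x - g x) 2 μ := ⟨(hf m).sub hg.1, hm.trans (by norm_num)⟩
    have h2 : MemLp (f m) 2 μ := by
      simpa [Pi.add_def] using h1.add hg
    exact h2.integrable_mul hφ
  · have h0 : Tendsto (fun m => eLpNorm (fun x => f m x - g x) 2 μ * eLpNorm φ 2 μ) atTop (𝓝 0) := by
      simpa using ENNReal.Tendsto.mul_const h (Or.inr hφ.2.ne)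
    refine tendsto_of_tendsto_of_tendsto_of_le_of_le tendsto_const_nhds h0
      (fun _ => zero_le) fun m => ?_
    have := eLpNorm_smul_le_mul_eLpNorm (p := 2) (q := 2) (r := 1) hφ.1 ((hf m).sub hg.1)
    refine le_trans (eLpNorm_mono fun x => le_of_eq ?_) this
    simp [sub_mul]

/-! ### Weak gradients -/

/-- Weak gradients are closed under `L²` limits: an `L²` limit of gradients of `C¹` functions is
the weak gradient of the `L²` limit of the functions. -/
theorem hasWeakGradient_of_tendsto {Ω : Set Plane} {v : ℕ → Plane → ℝ}
    {u : Plane → ℝ} {G : Plane → Plane} (hv : ∀ m, ContDiff ℝ 1 (v m))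
    (hu : MemLp u 2 (volume.restrict Ω)) (hG : MemLp G 2 (volume.restrict Ω))
    (h0 : Tendsto (fun m => eLpNorm (fun x => v m x - u x) 2 (volume.restrict Ω)) atTop (𝓝 0))
    (h1 : Tendsto (fun m => eLpNorm (fun x => gradient (v m) x - G x) 2 (volume.restrict Ω))
      atTop (𝓝 0)) :
    HasWeakGradient Ω u G := by
  intro φ hφ hφc hφΩ i
  have hφ1 : ContDiff ℝ 1 φ := hφ.of_le (by exact_mod_cast le_top)
  have hdφ : Continuous fun x => fderiv ℝ φ x (EuclideanSpace.single i 1) :=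
    (hφ1.continuous_fderiv (by norm_num)).clm_apply continuous_const
  have hdφc : HasCompactSupport fun x => fderiv ℝ φ x (EuclideanSpace.single i 1) :=
    hφc.fderiv_apply (𝕜 := ℝ) _
  have hL := tendsto_integral_mul_of_tendsto_eLpNorm_two
    (fun m => (hv m).continuous.aestronglyMeasurable) hu
    ((hdφ.memLp_of_hasCompactSupport hdφc (p := 2) (μ := volume)).restrict Ω) h0
  have hgc : ∀ m, Continuous fun x => gradient (v m) x := fun m =>
    (InnerProductSpace.toDual ℝ Plane).symm.continuous.comp ((hv m).continuous_fderiv (by norm_num))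
  have hR := tendsto_integral_mul_of_tendsto_eLpNorm_two (f := fun m x => gradient (v m) x i)
    (g := fun x => G x i) (μ := volume.restrict Ω)
    (fun m => ((EuclideanSpace.proj (𝕜 := ℝ) i).continuous.comp (hgc m)).aestronglyMeasurable)
    ((EuclideanSpace.proj (𝕜 := ℝ) i).comp_memLp' hG)
    ((hφ1.continuous.memLp_of_hasCompactSupport hφc (p := 2) (μ := volume)).restrict Ω)
    (tendsto_of_tendsto_of_tendsto_of_le_of_le tendsto_const_nhds h1
      (fun _ => zero_le) fun m => eLpNorm_mono fun x => by
        simpa using PiLp.norm_apply_le (gradient (v m) x - G x) i)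
  refine tendsto_nhds_unique hL ((hR.neg).congr fun m => ?_)
  have hcoord : ∀ x, gradient (v m) x i = fderiv ℝ (v m) x (EuclideanSpace.single i 1) := by
    intro x
    rw [← inner_gradient_left (𝕜 := ℝ), EuclideanSpace.inner_single_right]
    simp
  have hdv : Continuous fun x => fderiv ℝ (v m) x (EuclideanSpace.single i 1) :=
    ((hv m).continuous_fderiv (by norm_num)).clm_apply continuous_const
  have ibp := integral_mul_fderiv_eq_neg_fderiv_mul_of_integrable (μ := (volume : Measure Plane))
    (f := v m) (g := φ) (v := EuclideanSpace.single i 1)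
    ((hdv.mul hφ1.continuous).integrable_of_hasCompactSupport hφc.mul_left)
    (((hv m).continuous.mul hdφ).integrable_of_hasCompactSupport hdφc.mul_left)
    (((hv m).continuous.mul hφ1.continuous).integrable_of_hasCompactSupport hφc.mul_left)
    (fun x _ => ((hv m).differentiable (by norm_num)) x)
    (fun x _ => (hφ1.differentiable (by norm_num)) x)
  have hz : ∀ x ∉ Ω, φ x = 0 := fun x hx => image_eq_zero_of_notMem_tsupport fun h => hx (hφΩ h)
  have hz' : ∀ x ∉ Ω, fderiv ℝ φ x = 0 := fun x hx =>
    image_eq_zero_of_notMem_tsupport fun h => hx (hφΩ (tsupport_fderiv_subset ℝ h))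
  rw [setIntegral_eq_integral_of_forall_compl_eq_zero (fun x hx => by simp [hz x hx]),
    setIntegral_eq_integral_of_forall_compl_eq_zero (fun x hx => by simp [hz' x hx]), ibp]
  simp only [hcoord]

theorem HasWeakGradient.ae_eq {Ω : Set Plane} (hΩ : IsOpen Ω) {u : Plane → ℝ}
    {G G' : Plane → Plane} (h : HasWeakGradient Ω u G) (h' : HasWeakGradient Ω u G')
    (hG : MemLp G 2 (volume.restrict Ω)) (hG' : MemLp G' 2 (volume.restrict Ω)) :
    G =ᵐ[volume.restrict Ω] G' := by
  have hi : ∀ i : Fin 2, ∀ᵐ x ∂(volume : Measure Plane), x ∈ Ω → (G x - G' x) i = 0 := by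
    intro i
    have hm : ∀ {H : Plane → Plane}, MemLp H 2 (volume.restrict Ω) →
        MemLp (fun x => H x i) 2 (volume.restrict Ω) := fun hH =>
      (EuclideanSpace.proj (𝕜 := ℝ) i).comp_memLp' hH
    refine hΩ.ae_eq_zero_of_integral_contDiff_smul_eq_zero ?_ fun φ hφ hφc hφΩ => ?_
    · have := (hm (hG.sub hG')).locallyIntegrable (by norm_num)
      exact locallyIntegrableOn_of_locallyIntegrable_restrict this
    · have hφ2 : MemLp φ 2 (volume.restrict Ω) :=
        (hφ.continuous.memLp_of_hasCompactSupport hφc (p := 2) (μ := volume)).restrict Ω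
      have hz : ∀ x ∉ Ω, φ x = 0 := fun x hx =>
        image_eq_zero_of_notMem_tsupport fun h => hx (hφΩ h)
      rw [← setIntegral_eq_integral_of_forall_compl_eq_zero (s := Ω)
        (fun x hx => by simp [hz x hx])]
      have e := (h φ hφ hφc hφΩ i).symm.trans (h' φ hφ hφc hφΩ i)
      have e2 : ∫ x in Ω, φ x • (G x - G' x) i
          = (∫ x in Ω, G x i * φ x) - ∫ x in Ω, G' x i * φ x := by
        have i1 : Integrable (fun x => G x i * φ x) (volume.restrict Ω) :=
          (hm hG).integrable_mul hφ2
        have i2 : Integrable (fun x => G' x i * φ x) (volume.restrict Ω) :=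
          (hm hG').integrable_mul hφ2
        rw [← integral_sub i1 i2]
        congr 1; ext x; simp; ring
      rw [e2]; linarith
  rw [EventuallyEq, ae_restrict_iff' hΩ.measurableSet]
  filter_upwards [hi 0, hi 1] with x h0 h1 hx
  rw [← sub_eq_zero]
  ext i
  fin_cases i
  · exact h0 hx
  · exact h1 hx

theorem MemW12.weakGradient_spec {Ω : Set Plane} {u : Plane → ℝ} (hu : MemW12 Ω u) :
    MemLp (weakGradient Ω u) 2 (volume.restrict Ω) ∧ HasWeakGradient Ω u (weakGradient Ω u) := by
  rw [weakGradient, dif_pos hu]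
  exact hu.2.choose_spec

/-! ### Truncations of Sobolev functions and of their traces -/

/-- `F` is the pointwise limit of the functions `Φ m`, which are `C¹`, vanish at `0` and have slope
at most `1`, and whose derivatives converge pointwise to `d`. The limit `F` need not be
differentiable; at a kink, `d` is whichever value the approximation selects. -/
structure IsTruncation (Φ : ℕ → ℝ → ℝ) (F d : ℝ → ℝ) : Prop where
  contDiff : ∀ m, ContDiff ℝ 1 (Φ m)
  map_zero : ∀ m, Φ m 0 = 0
  abs_deriv_le : ∀ m t, |deriv (Φ m) t| ≤ 1
  tendsto : ∀ t, Tendsto (fun m => Φ m t) atTop (𝓝 (F t))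
  tendsto_deriv : ∀ t, Tendsto (fun m => deriv (Φ m) t) atTop (𝓝 (d t))

namespace IsTruncation

variable {Φ : ℕ → ℝ → ℝ} {F d : ℝ → ℝ}

theorem abs_sub_le_approx (h : IsTruncation Φ F d) (m : ℕ) (a b : ℝ) :
    |Φ m a - Φ m b| ≤ |a - b| := by
  have := lipschitzWith_of_nnnorm_deriv_le (C := 1) ((h.contDiff m).differentiable (by norm_num))
    (fun t => by simpa [← NNReal.coe_le_coe] using h.abs_deriv_le m t)
  simpa [Real.dist_eq] using this.dist_le_mul a b

theorem abs_sub_le (h : IsTruncation Φ F d) (a b : ℝ) : |F a - F b| ≤ |a - b| :=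
  le_of_tendsto (((h.tendsto a).sub (h.tendsto b)).abs)
    (Eventually.of_forall fun m => h.abs_sub_le_approx m a b)

theorem abs_le (h : IsTruncation Φ F d) (a : ℝ) : |F a| ≤ |a| := by
  have h0 : F 0 = 0 := tendsto_nhds_unique (h.tendsto 0) (by simp [h.map_zero])
  simpa [h0] using h.abs_sub_le a 0

theorem continuous (h : IsTruncation Φ F d) : Continuous F :=
  (LipschitzWith.of_dist_le_mul (K := 1) fun a b => by
    simpa [Real.dist_eq] using h.abs_sub_le a b).continuous

theorem continuous_deriv (h : IsTruncation Φ F d) (m : ℕ) : Continuous (deriv (Φ m)) :=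
  (h.contDiff m).continuous_deriv (by norm_num)

theorem measurable_deriv (h : IsTruncation Φ F d) : Measurable d :=
  measurable_of_tendsto_metrizable (fun m => (h.continuous_deriv m).measurable)
    (tendsto_pi_nhds.2 h.tendsto_deriv)

theorem abs_deriv_limit_le (h : IsTruncation Φ F d) (t : ℝ) : |d t| ≤ 1 :=
  le_of_tendsto (h.tendsto_deriv t).abs (Eventually.of_forall fun m => h.abs_deriv_le m t)

/-- Reflection `t ↦ -F (-t)`, which exchanges truncation from above and from below. -/
theorem reflect (h : IsTruncation Φ F d) :
    IsTruncation (fun m t => -Φ m (-t)) (fun t => -F (-t)) (fun t => d (-t)) := by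
  have hd : ∀ m t, deriv (fun t => -Φ m (-t)) t = deriv (Φ m) (-t) := by
    intro m t
    rw [deriv.fun_neg, deriv_comp_neg, neg_neg]
  refine ⟨fun m => ((h.contDiff m).comp contDiff_neg).neg, fun m => by simp [h.map_zero],
    fun m t => ?_, fun t => (h.tendsto (-t)).neg, fun t => ?_⟩
  · rw [hd]; exact h.abs_deriv_le m _
  · simp only [hd]; exact h.tendsto_deriv (-t)

theorem memLp {α : Type*} [MeasurableSpace α] {μ : Measure α} {u : α → ℝ}
    (h : IsTruncation Φ F d) (hu : MemLp u 2 μ) : MemLp (fun x => F (u x)) 2 μ :=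
  hu.of_le (h.continuous.comp_aestronglyMeasurable hu.1) (ae_of_all _ fun x => h.abs_le (u x))

/-- Whatever sequence `v` approximates `u` in `L²`, the smoothed truncations of `v` approximate the
truncation of `u`, because the `Φ m` share one Lipschitz constant. -/
theorem tendsto_eLpNorm_comp {α : Type*} [MeasurableSpace α] {μ : Measure α} {u : α → ℝ}
    {v : ℕ → α → ℝ} (h : IsTruncation Φ F d) (hu : MemLp u 2 μ)
    (hv : ∀ k, AEStronglyMeasurable (v k) μ)
    (hvu : Tendsto (fun k => eLpNorm (fun x => v k x - u x) 2 μ) atTop (𝓝 0)) :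
    Tendsto (fun m => eLpNorm (fun x => Φ m (v m x) - F (u x)) 2 μ) atTop (𝓝 0) := by
  have hΦ : ∀ m {w : α → ℝ}, AEStronglyMeasurable w μ →
      AEStronglyMeasurable (fun x => Φ m (w x)) μ := fun m _ hw =>
    (h.contDiff m).continuous.comp_aestronglyMeasurable hw
  have hF := h.continuous.comp_aestronglyMeasurable hu.1
  have h2 : Tendsto (fun m => eLpNorm (fun x => Φ m (u x) - F (u x)) 2 μ) atTop (𝓝 0) := by
    refine tendsto_eLpNorm_two_zero_of_dominated (b := fun x => 2 * u x)
      (fun m => (hΦ m hu.1).sub hF) (hu.const_mul 2) (fun m => ae_of_all _ fun x => ?_)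
      (ae_of_all _ fun x => ?_)
    · have h1 := h.abs_sub_le_approx m (u x) 0
      have h3 := h.abs_le (u x)
      rw [h.map_zero, sub_zero, sub_zero] at h1
      simp only [Real.norm_eq_abs, abs_mul, abs_two]
      linarith [abs_sub (Φ m (u x)) (F (u x))]
    · simpa using (h.tendsto (u x)).sub_const (F (u x))
  refine tendsto_of_tendsto_of_tendsto_of_le_of_le tendsto_const_nhds
    (by simpa using hvu.add h2) (fun _ => zero_le) fun m => ?_
  calc eLpNorm (fun x => Φ m (v m x) - F (u x)) 2 μ
      = eLpNorm ((fun x => Φ m (v m x) - Φ m (u x)) + fun x => Φ m (u x) - F (u x)) 2 μ := by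
        congr 1; ext x; simp
    _ ≤ eLpNorm (fun x => Φ m (v m x) - Φ m (u x)) 2 μ
        + eLpNorm (fun x => Φ m (u x) - F (u x)) 2 μ :=
        eLpNorm_add_le ((hΦ m (hv m)).sub (hΦ m hu.1)) ((hΦ m hu.1).sub hF) (by norm_num)
    _ ≤ eLpNorm (fun x => v m x - u x) 2 μ + eLpNorm (fun x => Φ m (u x) - F (u x)) 2 μ := by
        gcongr
        exact eLpNorm_mono fun x => h.abs_sub_le_approx m _ _

theorem gradient_comp (h : IsTruncation Φ F d) (m : ℕ) {v : Plane → ℝ} (hv : ContDiff ℝ 1 v)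
    (x : Plane) :
    gradient (fun y => Φ m (v y)) x = deriv (Φ m) (v x) • gradient v x := by
  have h1 : HasFDerivAt (fun y => Φ m (v y)) (deriv (Φ m) (v x) • fderiv ℝ v x) x :=
    (((h.contDiff m).differentiable (by norm_num) (v x)).hasDerivAt).comp_hasFDerivAt x
      ((hv.differentiable (by norm_num) x).hasFDerivAt)
  simp [gradient, h1.fderiv]

/-- Along a subsequence of any `C¹` sequence converging to `u` in `W^{1,2}`, the gradients of the
smoothed truncations converge in `L²` to `d(u) ∇u`. The subsequence is diagonal: for the `m`-th
smoothing, an index is chosen at which the `m`-th chain rule is already accurate to `1 / (m + 1)`. -/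
theorem exists_tendsto_gradient (h : IsTruncation Φ F d) {μ : Measure Plane} {u : Plane → ℝ}
    {G : Plane → Plane} {v : ℕ → Plane → ℝ} (hv : ∀ k, ContDiff ℝ 1 (v k))
    (hu : MemLp u 2 μ) (hG : MemLp G 2 μ)
    (hvu : Tendsto (fun k => eLpNorm (fun x => v k x - u x) 2 μ) atTop (𝓝 0))
    (hvG : Tendsto (fun k => eLpNorm (fun x => gradient (v k) x - G x) 2 μ) atTop (𝓝 0)) :
    ∃ κ : ℕ → ℕ, Tendsto κ atTop atTop ∧
      Tendsto (fun m => eLpNorm (fun x => gradient (fun y => Φ m (v (κ m) y)) x - d (u x) • G x)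
        2 μ) atTop (𝓝 0) := by
  obtain ⟨ns, hns, hae⟩ := (tendstoInMeasure_of_tendsto_eLpNorm (p := 2) (μ := μ) (f := v) (g := u)
    (by norm_num) (fun k => (hv k).continuous.aestronglyMeasurable) hu.1 hvu).exists_seq_tendsto_ae
  have hgc : ∀ k, AEStronglyMeasurable (fun x => gradient (v k) x) μ := fun k =>
    ((InnerProductSpace.toDual ℝ Plane).symm.continuous.comp
      ((hv k).continuous_fderiv (by norm_num))).aestronglyMeasurable
  have hdv : ∀ m k, AEStronglyMeasurable (fun x => deriv (Φ m) (v k x)) μ := fun m k =>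
    ((h.continuous_deriv m).comp (hv k).continuous).aestronglyMeasurable
  have hdu : ∀ m, AEStronglyMeasurable (fun x => deriv (Φ m) (u x)) μ := fun m =>
    (h.continuous_deriv m).comp_aestronglyMeasurable hu.1
  have hd : AEStronglyMeasurable (fun x => d (u x)) μ :=
    (h.measurable_deriv.comp_aemeasurable hu.1.aemeasurable).aestronglyMeasurable
  have hbound : ∀ {a b : ℝ} (y : Plane), |a| ≤ 1 → |b| ≤ 1 → ‖(a - b) • y‖ ≤ ‖(2 : ℝ) • y‖ := by
    intro a b y ha hb
    rw [norm_smul, norm_smul]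
    gcongr
    simp only [Real.norm_eq_abs, abs_two]
    linarith [abs_sub a b]
  have hB : Tendsto (fun m => eLpNorm (fun x => (deriv (Φ m) (u x) - d (u x)) • G x) 2 μ)
      atTop (𝓝 0) :=
    tendsto_eLpNorm_two_zero_of_dominated (fun m => ((hdu m).sub hd).smul hG.1)
      (hG.const_smul (2 : ℝ))
      (fun m => ae_of_all _ fun x => hbound _ (h.abs_deriv_le m _) (h.abs_deriv_limit_le _))
      (ae_of_all _ fun x => by
        simpa using ((h.tendsto_deriv (u x)).sub_const (d (u x))).smul_const (G x))
  have hA : ∀ m, Tendsto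
      (fun k => eLpNorm (fun x => (deriv (Φ m) (v (ns k) x) - deriv (Φ m) (u x)) • G x) 2 μ)
      atTop (𝓝 0) := by
    intro m
    refine tendsto_eLpNorm_two_zero_of_dominated (fun k => ((hdv m _).sub (hdu m)).smul hG.1)
      (hG.const_smul (2 : ℝ))
      (fun k => ae_of_all _ fun x => hbound _ (h.abs_deriv_le m _) (h.abs_deriv_le m _)) ?_
    filter_upwards [hae] with x hx
    have := (((h.continuous_deriv m).tendsto (u x)).comp hx).sub_const (deriv (Φ m) (u x))
    simpa using this.smul_const (G x)
  have hchoose : ∀ m : ℕ, ∃ k, m ≤ k ∧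
      eLpNorm (fun x => (deriv (Φ m) (v (ns k) x) - deriv (Φ m) (u x)) • G x) 2 μ
        ≤ ((m : ℝ≥0∞) + 1)⁻¹ := by
    intro m
    have hpos : (0 : ℝ≥0∞) < ((m : ℝ≥0∞) + 1)⁻¹ :=
      ENNReal.inv_pos.2 (by finiteness)
    obtain ⟨k, hk, hk'⟩ :=
      (((hA m).eventually_lt_const hpos).and (eventually_ge_atTop m)).exists
    exact ⟨k, hk', hk.le⟩
  choose k hmk hk using hchoose
  have hκ : Tendsto (fun m => ns (k m)) atTop atTop :=
    hns.tendsto_atTop.comp (tendsto_atTop_mono hmk tendsto_id)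
  refine ⟨fun m => ns (k m), hκ, ?_⟩
  have hinv : Tendsto (fun m : ℕ => ((m : ℝ≥0∞) + 1)⁻¹) atTop (𝓝 0) := by
    have := (tendsto_add_atTop_iff_nat 1).2 ENNReal.tendsto_inv_nat_nhds_zero
    simpa using this
  refine tendsto_of_tendsto_of_tendsto_of_le_of_le tendsto_const_nhds
    (by simpa using ((hvG.comp hκ).add hinv).add hB) (fun _ => zero_le) fun m => ?_
  have s1 : AEStronglyMeasurable (fun x =>
      deriv (Φ m) (v (ns (k m)) x) • (gradient (v (ns (k m))) x - G x)) μ :=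
    (hdv m (ns (k m))).smul ((hgc (ns (k m))).sub hG.1)
  have s2 : AEStronglyMeasurable (fun x =>
      (deriv (Φ m) (v (ns (k m)) x) - deriv (Φ m) (u x)) • G x) μ :=
    ((hdv m (ns (k m))).sub (hdu m)).smul hG.1
  have s3 : AEStronglyMeasurable (fun x => (deriv (Φ m) (u x) - d (u x)) • G x) μ :=
    ((hdu m).sub hd).smul hG.1
  -- Errors from approximating `u` by `v` in the gradient, in the slope, and from smoothing `F`.
  have split : (fun x => gradient (fun y => Φ m (v (ns (k m)) y)) x - d (u x) • G x)
      = ((fun x => deriv (Φ m) (v (ns (k m)) x) • (gradient (v (ns (k m))) x - G x))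
        + fun x => (deriv (Φ m) (v (ns (k m)) x) - deriv (Φ m) (u x)) • G x)
        + fun x => (deriv (Φ m) (u x) - d (u x)) • G x := by
    ext1 x
    simp only [h.gradient_comp m (hv _), Pi.add_apply]
    module
  rw [split]
  refine (eLpNorm_add_le (s1.add s2) s3 (by norm_num)).trans ?_
  gcongr
  refine (eLpNorm_add_le s1 s2 (by norm_num)).trans ?_
  refine add_le_add (eLpNorm_mono fun x => ?_) (hk m)
  rw [norm_smul]
  exact mul_le_of_le_one_left (norm_nonneg _) (h.abs_deriv_le m _)

/-- The weak gradient of a truncation of `u` is `d(u) ∇u`, and its trace is the truncation of the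
trace of `u`. -/
theorem isTrace (h : IsTruncation Φ F d) {Ω : Set Plane} (hΩ : IsOpen Ω) {u g : Plane → ℝ}
    (hu : IsTrace Ω u g) :
    IsTrace Ω (fun x => F (u x)) (fun x => F (g x)) ∧
      weakGradient Ω (fun x => F (u x)) =ᵐ[volume.restrict Ω]
        fun x => d (u x) • weakGradient Ω u x := by
  obtain ⟨huW, hg, v, hv, hvu, hvG, hvg⟩ := hu
  have hG := huW.weakGradient_spec.1
  have hd : AEStronglyMeasurable (fun x => d (u x)) (volume.restrict Ω) :=
    (h.measurable_deriv.comp_aemeasurable huW.1.1.aemeasurable).aestronglyMeasurable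
  have hdG : MemLp (fun x => d (u x) • weakGradient Ω u x) 2 (volume.restrict Ω) :=
    hG.of_le (hd.smul hG.1) (ae_of_all _ fun x => by
      rw [norm_smul]
      exact mul_le_of_le_one_left (norm_nonneg _) (h.abs_deriv_limit_le _))
  obtain ⟨κ, hκ, hgrad⟩ := h.exists_tendsto_gradient hv huW.1 hG hvu hvG
  have hw : ∀ m, ContDiff ℝ 1 (fun y => Φ m (v (κ m) y)) := fun m =>
    (h.contDiff m).comp (hv (κ m))
  have hL := h.tendsto_eLpNorm_comp huW.1
    (fun m => (hv (κ m)).continuous.aestronglyMeasurable) (hvu.comp hκ)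
  have hb := h.tendsto_eLpNorm_comp hg
    (fun m => (hv (κ m)).continuous.aestronglyMeasurable) (hvg.comp hκ)
  have hFu := h.memLp huW.1
  have hweak := hasWeakGradient_of_tendsto hw hFu hdG hL hgrad
  have hW : MemW12 Ω (fun x => F (u x)) := ⟨hFu, _, hdG, hweak⟩
  have hEq := hW.weakGradient_spec.2.ae_eq hΩ hweak hW.weakGradient_spec.1 hdG
  refine ⟨⟨hW, h.memLp hg, fun m y => Φ m (v (κ m) y), hw, hL, ?_, hb⟩, hEq⟩
  refine hgrad.congr fun m => eLpNorm_congr_ae ?_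
  filter_upwards [hEq] with x hx
  rw [hx]

end IsTruncation

/-- The functions `t ↦ (t - s)⁺` with `s ≥ 0` are truncations; the derivative is read as `0` at the
kink. -/
theorem exists_isTruncation_sub_max {s : ℝ} (hs : 0 ≤ s) :
    ∃ Φ, IsTruncation Φ (fun t => max (t - s) 0) (fun t => if s < t then 1 else 0) := by
  -- The slopes are ramps rising from `0` at `s` to `1` at `s + 1 / m`.
  set ψ : ℕ → ℝ → ℝ := fun m t => min (m * max (t - s) 0) 1 with hψ
  have hc : ∀ m, Continuous (ψ m) := fun m => by fun_prop
  have h0 : ∀ m t, 0 ≤ ψ m t := fun m t => by positivity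
  have h1 : ∀ m t, |ψ m t| ≤ 1 := fun m t => by
    rw [abs_of_nonneg (h0 m t)]; exact min_le_right _ _
  have hd : ∀ m, deriv (fun t => ∫ τ in (0 : ℝ)..t, ψ m τ) = ψ m := fun m => by
    ext t; exact (hc m).deriv_integral _ _ _
  have hlim : ∀ t, Tendsto (fun m => ψ m t) atTop (𝓝 (if s < t then (1 : ℝ) else 0)) := by
    intro t
    split_ifs with h
    · obtain ⟨N, hN⟩ := exists_nat_gt (t - s)⁻¹
      refine tendsto_const_nhds.congr' ?_
      filter_upwards [eventually_ge_atTop N] with m hm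
      have hpos : 0 < t - s := sub_pos.2 h
      have hm' : (N : ℝ) ≤ m := by exact_mod_cast hm
      have : 1 ≤ (m : ℝ) * (t - s) := by
        have := mul_le_mul_of_nonneg_right (hN.le.trans hm') hpos.le
        rwa [inv_mul_cancel₀ hpos.ne'] at this
      simp [hψ, max_eq_left hpos.le, this]
    · have : t - s ≤ 0 := by linarith
      simp [hψ, this]
  refine ⟨fun m t => ∫ τ in (0 : ℝ)..t, ψ m τ, fun m => ?_, fun m => by simp, fun m t => ?_,
    fun t => ?_, fun t => ?_⟩
  · rw [contDiff_one_iff_deriv, hd]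
    exact ⟨fun t => ((hc m).integral_hasStrictDerivAt 0 t).hasDerivAt.differentiableAt, hc m⟩
  · rw [hd]; exact h1 m t
  · have key : Tendsto (fun m => ∫ τ in (0 : ℝ)..t, ψ m τ) atTop
        (𝓝 (∫ τ in (0 : ℝ)..t, if s < τ then (1 : ℝ) else 0)) :=
      intervalIntegral.tendsto_integral_filter_of_dominated_convergence (fun _ => 1)
        (Eventually.of_forall fun m => (hc m).aestronglyMeasurable)
        (Eventually.of_forall fun m => ae_of_all _ fun τ _ => h1 m τ) (by simp)
        (ae_of_all _ fun τ _ => hlim τ)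
    have hval : ∫ τ in (0 : ℝ)..t, (if s < τ then (1 : ℝ) else 0) = max (t - s) 0 := by
      have hi : ∀ a b : ℝ, IntervalIntegrable (fun τ => if s < τ then (1 : ℝ) else 0)
          volume a b := fun a b =>
        (monotone_iff_forall_lt.2 fun x y hxy => by
          split_ifs <;> first | (norm_num; done) | linarith).intervalIntegrable
      have hzero : ∀ b, b ≤ s → ∫ τ in (0 : ℝ)..b, (if s < τ then (1 : ℝ) else 0) = 0 := by
        intro b hb
        refine intervalIntegral.integral_zero_ae (ae_of_all _ fun τ hτ => if_neg ?_)
        have := hτ.2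
        exact not_lt.2 (this.trans (max_le hs hb))
      rcases le_total t s with h | h
      · rw [hzero t h, max_eq_right (by linarith)]
      · rw [← intervalIntegral.integral_add_adjacent_intervals (hi 0 s) (hi s t), hzero s le_rfl,
          zero_add, max_eq_left (by linarith)]
        rw [intervalIntegral.integral_congr_ae (g := fun _ => (1 : ℝ)) (ae_of_all _ fun τ hτ => by
          rw [uIoc_of_le h] at hτ
          exact if_pos hτ.1)]
        simp
    rwa [hval] at key
  · simp only [hd]; exact hlim t

/-! ### The microstructure and the coefficients -/

theorem ae_toLp_fract_mem_unitCell {ε : ℝ} (hε : 0 < ε) :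
    ∀ᵐ x ∂(volume : Measure Plane),
      (WithLp.toLp 2 fun i => Int.fract ((ε⁻¹ • x) i) : Plane) ∈ unitCell := by
  have hnull : ∀ (i : Fin 2) (k : ℤ), ∀ᵐ x ∂(volume : Measure Plane), x i ≠ ε * k := by
    intro i k
    have h0 : ∀ᵐ y ∂(volume : Measure (Fin 2 → ℝ)), y i ≠ ε * k := by
      simpa [ae_iff, volume_pi] using
        Measure.pi_hyperplane (fun _ : Fin 2 => (volume : Measure ℝ)) i (ε * k)
    exact (PiLp.volume_preserving_ofLp (Fin 2)).quasiMeasurePreserving.ae h0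
  filter_upwards [ae_all_iff.2 fun i => ae_all_iff.2 (hnull i)] with x hx i
  refine ⟨(Int.fract_nonneg _).lt_of_ne fun h0 => ?_, Int.fract_lt_one _⟩
  obtain ⟨k, hk⟩ := Int.fract_eq_zero_iff.1 h0.symm
  refine hx i k ?_
  have : (k : ℝ) = ε⁻¹ * x i := by simpa using hk
  rw [this, mul_inv_cancel_left₀ hε.ne']

theorem measurable_periodicIndicator {A : Set Plane} (hA : MeasurableSet A) :
    Measurable (periodicIndicator A) := by
  refine (measurable_const.indicator hA).comp ?_
  refine (PiLp.continuous_toLp 2 _).measurable.comp (measurable_pi_lambda _ fun i => ?_)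
  exact measurable_fract.comp (EuclideanSpace.proj (𝕜 := ℝ) i).continuous.measurable

theorem periodicIndicator_nonneg (A : Set Plane) (y : Plane) : 0 ≤ periodicIndicator A y :=
  indicator_nonneg (fun _ _ => zero_le_one) _

theorem periodicIndicator_le_one (A : Set Plane) (y : Plane) : periodicIndicator A y ≤ 1 :=
  indicator_le_self' (fun _ _ => zero_le_one) _

namespace PressureData

variable {D : PressureData}

theorem measurable_chic (hD : D.Admissible) (ε : ℝ) : Measurable (D.chic ε) :=
  (measurable_periodicIndicator hD.measurableSet_Yc).comp (measurable_const_smul ε⁻¹)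

theorem measurable_chia (hD : D.Admissible) (ε : ℝ) : Measurable (D.chia ε) :=
  (measurable_periodicIndicator hD.measurableSet_Ya).comp (measurable_const_smul ε⁻¹)

theorem chic_nonneg (ε : ℝ) (x : Plane) : 0 ≤ D.chic ε x := periodicIndicator_nonneg _ _

theorem chia_nonneg (ε : ℝ) (x : Plane) : 0 ≤ D.chia ε x := periodicIndicator_nonneg _ _

/-- Off the null grid of cell boundaries, every point lies in one of the two materials. -/
theorem ae_chic_pos_or_chia_pos (hD : D.Admissible) {ε : ℝ} (hε : 0 < ε) :
    ∀ᵐ x ∂(volume : Measure Plane), 0 < D.chic ε x ∨ 0 < D.chia ε x := by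
  filter_upwards [ae_toLp_fract_mem_unitCell hε] with x hx
  rw [← hD.union_cells] at hx
  rcases hx with h | h
  · left; rw [chic, periodicIndicator, indicator_of_mem h]; exact one_pos
  · right; rw [chia, periodicIndicator, indicator_of_mem h]; exact one_pos

theorem strictMono_S (hD : D.Admissible) : StrictMono D.S :=
  strictMono_of_deriv_pos fun ξ => (hD.S_deriv_bounds ξ).1

theorem continuous_phic (hD : D.Admissible) : Continuous D.phic :=
  (LipschitzWith.of_dist_le_mul (K := ⟨D.Cphi, hD.Cphi_pos.le⟩) fun a b => by
    rw [Real.dist_eq, Real.dist_eq]; exact hD.phic_lipschitz a b).continuous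

theorem continuous_f (hD : D.Admissible) :
    Continuous fun ξ : ℝ × ℝ × ℝ => D.f ξ.1 ξ.2.1 ξ.2.2 := by
  obtain ⟨L, hL⟩ := hD.f_lipschitz
  refine continuous_iff_continuousAt.2 fun η => tendsto_iff_dist_tendsto_zero.2 ?_
  refine squeeze_zero (fun _ => dist_nonneg) (fun ξ => hL ξ.1 ξ.2.1 ξ.2.2 η.1 η.2.1 η.2.2) ?_
  have : Continuous fun ξ : ℝ × ℝ × ℝ =>
      L * (|ξ.1 - η.1| + |ξ.2.1 - η.2.1| + |ξ.2.2 - η.2.2|) := by fun_prop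
  simpa using this.tendsto η

/-! ### Testing the discretized equation -/

/-- The zero-order part of the discretized pressure equation, with the hydration sink moved to the
left-hand side. -/
noncomputable def residual (D : PressureData) (ε h : ℝ) (pPrev thPrev rPrev r p : Plane → ℝ) (x : Plane) : ℝ :=
  D.rhow * (D.chic ε x * ((D.phic (r x) * D.S (p x) - D.phic (rPrev x) * D.S (pPrev x)) / h))
    + D.rhow * (D.chia ε x * D.phia * ((D.S (p x) - D.S (pPrev x)) / h))
    - D.alpha₁ * (D.chic ε x * D.f (p x) (thPrev x) (rPrev x))

/-- If the residual, the diffusion and the boundary flux all have a favourable sign against a test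
function, and the first and the last strictly so where the test function and its trace do not
vanish, then both vanish. -/
theorem SolvesStep.ae_eq_zero {Ω : Set Plane} {ε h : ℝ}
    {pPrev thPrev rPrev r p q ζ ζb : Plane → ℝ}
    (hs : D.SolvesStep Ω ε h pPrev thPrev rPrev r p q) (hD : D.Admissible)
    (hΩ : IsFiniteMeasure (volume.restrict Ω))
    (hpPrev : AEStronglyMeasurable pPrev (volume.restrict Ω))
    (hth : AEStronglyMeasurable thPrev (volume.restrict Ω))
    (hrPrev : AEStronglyMeasurable rPrev (volume.restrict Ω))
    (hr : AEStronglyMeasurable r (volume.restrict Ω))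
    (hp : AEStronglyMeasurable p (volume.restrict Ω))
    (hζ : IsTrace Ω ζ ζb)
    (hres : ∀ᵐ x ∂(volume.restrict Ω), ζ x ≠ 0 →
      0 < D.residual ε h pPrev thPrev rPrev r p x * ζ x)
    (hgrad : ∀ᵐ x ∂(volume.restrict Ω), 0 ≤ inner ℝ (weakGradient Ω p x) (weakGradient Ω ζ x))
    (hbdry : ∀ x, ζb x ≠ 0 → 0 < (q x - D.pinf) * ζb x)
    (hint : Integrable (fun x => (q x - D.pinf) * ζb x) (surfaceMeasure Ω)) :
    (∀ᵐ x ∂(volume.restrict Ω), ζ x = 0) ∧ ∀ᵐ x ∂(surfaceMeasure Ω), ζb x = 0 := by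
  have heq := hs ζ ζb hζ.1 hζ
  have hζ1 : MemLp ζ 1 (volume.restrict Ω) := hζ.1.1.mono_exponent (by norm_num)
  have hi : ∀ {a : Plane → ℝ}, MemLp a ⊤ (volume.restrict Ω) →
      Integrable (fun x => a x * ζ x) (volume.restrict Ω) := fun ha => ha.integrable_mul hζ1
  have hSc : Continuous D.S := hD.S_contDiff.continuous
  have hS : ∀ {u : Plane → ℝ}, AEStronglyMeasurable u (volume.restrict Ω) →
      MemLp (fun x => D.S (u x)) ⊤ (volume.restrict Ω) := fun hu =>
    memLp_top_of_bound (hSc.comp_aestronglyMeasurable hu) D.Cs (ae_of_all _ fun x => by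
      rw [Real.norm_eq_abs, abs_of_pos (hD.S_bounds _).1]; exact (hD.S_bounds _).2)
  have hφ : ∀ {u : Plane → ℝ}, AEStronglyMeasurable u (volume.restrict Ω) →
      MemLp (fun x => D.phic (u x)) ⊤ (volume.restrict Ω) := fun hu =>
    memLp_top_of_bound ((continuous_phic hD).comp_aestronglyMeasurable hu) D.phi₂
      (ae_of_all _ fun x => by
        rw [Real.norm_eq_abs, abs_of_pos (hD.phi₁_pos.trans_le (hD.phic_bounds _).1)]
        exact (hD.phic_bounds _).2)
  have hf : MemLp (fun x => D.f (p x) (thPrev x) (rPrev x)) ⊤ (volume.restrict Ω) :=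
    memLp_top_of_bound ((continuous_f hD).comp_aestronglyMeasurable
      (hp.prodMk (hth.prodMk hrPrev))) D.Cf (ae_of_all _ fun x => by
        rw [Real.norm_eq_abs, abs_of_nonneg (hD.f_bounds _ _ _).1]; exact (hD.f_bounds _ _ _).2)
  have hχ : ∀ {A : Set Plane} (χ : Plane → ℝ), Measurable χ →
      (∀ x, χ x = periodicIndicator A (ε⁻¹ • x)) → MemLp χ ⊤ (volume.restrict Ω) :=
    fun χ hχ he => memLp_top_of_bound hχ.aestronglyMeasurable 1 (ae_of_all _ fun x => by
      rw [he, Real.norm_eq_abs, abs_of_nonneg (periodicIndicator_nonneg _ _)]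
      exact periodicIndicator_le_one _ _)
  have hχc := hχ _ (measurable_chic hD ε) fun _ => rfl
  have hχa := hχ _ (measurable_chia hD ε) fun _ => rfl
  have hmul : ∀ {a b : Plane → ℝ}, MemLp a ⊤ (volume.restrict Ω) →
      MemLp b ⊤ (volume.restrict Ω) → MemLp (fun x => a x * b x) ⊤ (volume.restrict Ω) :=
    fun ha hb => hb.mul' ha
  have i1 := hi (hmul hχc ((((hmul (hφ hr) (hS hp)).sub (hmul (hφ hrPrev) (hS hpPrev)))).mul_const
    h⁻¹))
  have i2 := hi (hmul (hχa.mul_const D.phia) (((hS hp).sub (hS hpPrev)).mul_const h⁻¹))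
  have i3 := hi (hmul hχc hf)
  simp only [Pi.sub_apply, ← div_eq_mul_inv] at i1 i2
  have j1 := i1.const_mul D.rhow
  have j2 := i2.const_mul D.rhow
  have j3 := i3.const_mul D.alpha₁
  have j12 : Integrable (fun x => D.rhow * (D.chic ε x *
      ((D.phic (r x) * D.S (p x) - D.phic (rPrev x) * D.S (pPrev x)) / h) * ζ x)
      + D.rhow * (D.chia ε x * D.phia * ((D.S (p x) - D.S (pPrev x)) / h) * ζ x))
      (volume.restrict Ω) := j1.add j2
  have hpt : (fun x => D.residual ε h pPrev thPrev rPrev r p x * ζ x) = fun x =>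
      D.rhow * (D.chic ε x *
        ((D.phic (r x) * D.S (p x) - D.phic (rPrev x) * D.S (pPrev x)) / h) * ζ x)
      + D.rhow * (D.chia ε x * D.phia * ((D.S (p x) - D.S (pPrev x)) / h) * ζ x)
      - D.alpha₁ * (D.chic ε x * D.f (p x) (thPrev x) (rPrev x) * ζ x) := by
    ext x
    simp only [residual]
    ring
  have hri : Integrable (fun x => D.residual ε h pPrev thPrev rPrev r p x * ζ x)
      (volume.restrict Ω) := by
    rw [hpt]; exact j12.sub j3
  have hsum : ∫ x in Ω, D.residual ε h pPrev thPrev rPrev r p x * ζ x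
      = D.rhow * (∫ x in Ω, D.chic ε x *
        ((D.phic (r x) * D.S (p x) - D.phic (rPrev x) * D.S (pPrev x)) / h) * ζ x)
      + D.rhow * (∫ x in Ω, D.chia ε x * D.phia * ((D.S (p x) - D.S (pPrev x)) / h) * ζ x)
      - D.alpha₁ * (∫ x in Ω, D.chic ε x * D.f (p x) (thPrev x) (rPrev x) * ζ x) := by
    rw [hpt, integral_sub j12 j3, integral_add j1 j2, integral_const_mul, integral_const_mul,
      integral_const_mul]
  have hr0 : 0 ≤ᵐ[volume.restrict Ω] fun x => D.residual ε h pPrev thPrev rPrev r p x * ζ x := by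
    filter_upwards [hres] with x hx
    by_cases h0 : ζ x = 0
    · simp [h0]
    · exact (hx h0).le
  have hb0 : 0 ≤ᵐ[surfaceMeasure Ω] fun x => (q x - D.pinf) * ζb x := ae_of_all _ fun x => by
    by_cases h0 : ζb x = 0
    · simp [h0]
    · exact (hbdry x h0).le
  have hdiff : 0 ≤ ∫ x in Ω,
      (D.chic ε x * (D.kc (rPrev x) / D.mu (thPrev x)) * D.kR (D.S (p x))
        + D.chia ε x * (D.ka / D.mu (thPrev x)) * D.kR (D.S (p x)))
        * inner ℝ (weakGradient Ω p x) (weakGradient Ω ζ x) := by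
    -- Only the sign is used; a non-integrable integrand would contribute `0`, which is harmless.
    refine integral_nonneg_of_ae ?_
    filter_upwards [hgrad] with x hx
    have hmu : 0 < D.mu (thPrev x) := hD.mu₁_pos.trans_le (hD.mu_bounds _).1
    have hkc : 0 < D.kc (rPrev x) := hD.k₁_pos.trans_le (hD.kc_bounds _).1
    have hkR : 0 < D.kR (D.S (p x)) := hD.kR_pos _ ⟨(hD.S_bounds _).1.le, (hD.S_bounds _).2⟩
    have hka := hD.ka_pos
    have h1 := chic_nonneg (D := D) ε x
    have h2 := chia_nonneg (D := D) ε x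
    exact mul_nonneg (by positivity) hx
  have hR := integral_nonneg_of_ae hr0
  have hB := integral_nonneg_of_ae hb0
  have hG := mul_nonneg hD.rhow_pos.le hdiff
  have hB' := mul_nonneg hD.betae_pos.le hB
  have hR0 : ∫ x in Ω, D.residual ε h pPrev thPrev rPrev r p x * ζ x = 0 := by linarith
  have hB0 : D.betae * ∫ x, (q x - D.pinf) * ζb x ∂(surfaceMeasure Ω) = 0 := by linarith
  have hB1 := (mul_eq_zero.1 hB0).resolve_left hD.betae_pos.ne'
  constructor
  · filter_upwards [hres, (integral_eq_zero_iff_of_nonneg_ae hr0 hri).1 hR0] with x hx hx0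
    by_contra hne
    exact (hx hne).ne' hx0
  · filter_upwards [(integral_eq_zero_iff_of_nonneg_ae hb0 hint).1 hB1] with x hx0
    by_contra hne
    exact (hbdry x hne).ne' hx0

/-- Below `pinf` the hydration rate vanishes, so the memory function has not moved and the residual
has the sign of the change of saturation. -/
theorem residual_neg (hD : D.Admissible) {ε h : ℝ} (hh : 0 < h)
    {pPrev thPrev rPrev r p : Plane → ℝ} {x : Plane} (hχ : 0 < D.chic ε x ∨ 0 < D.chia ε x)
    (hr : r x = rPrev x + h * D.f (p x) (thPrev x) (rPrev x)) (hPrev : D.pinf ≤ pPrev x)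
    (hp : p x < D.pinf) : D.residual ε h pPrev thPrev rPrev r p x < 0 := by
  have hf := hD.f_eq_zero (p x) (thPrev x) (rPrev x) hp.le
  rw [hf, mul_zero, add_zero] at hr
  have hS : 0 < (D.S (pPrev x) - D.S (p x)) / h :=
    div_pos (sub_pos.2 (strictMono_S hD (hp.trans_le hPrev))) hh
  have hφ : 0 < D.phic (rPrev x) := hD.phi₁_pos.trans_le (hD.phic_bounds _).1
  have hφa := hD.phia_pos
  have hc := chic_nonneg (D := D) ε x
  have ha := chia_nonneg (D := D) ε x
  have hpos : 0 < D.chic ε x * D.phic (rPrev x) + D.chia ε x * D.phia := by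
    rcases hχ with h | h <;> positivity
  have := mul_pos (mul_pos hD.rhow_pos hpos) hS
  have e : D.residual ε h pPrev thPrev rPrev r p x
      = -(D.rhow * (D.chic ε x * D.phic (rPrev x) + D.chia ε x * D.phia)
        * ((D.S (pPrev x) - D.S (p x)) / h)) := by
    rw [residual, hf, hr]; ring
  linarith

/-- Where the pressure increases, the growth of the saturation makes the residual positive: the
change of porosity costs at most `rhow * Cphi * Cs * f`, which the sink `-alpha₁ * f` absorbs. -/
theorem residual_pos (hD : D.Admissible) {ε h : ℝ} (hh : 0 < h)
    {pPrev thPrev rPrev r p : Plane → ℝ} {x : Plane} (hχ : 0 < D.chic ε x ∨ 0 < D.chia ε x)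
    (hr : r x = rPrev x + h * D.f (p x) (thPrev x) (rPrev x)) (hp : pPrev x < p x) :
    0 < D.residual ε h pPrev thPrev rPrev r p x := by
  set F := D.f (p x) (thPrev x) (rPrev x) with hF
  have hF0 : 0 ≤ F := (hD.f_bounds _ _ _).1
  have hS : 0 < (D.S (p x) - D.S (pPrev x)) / h :=
    div_pos (sub_pos.2 (strictMono_S hD hp)) hh
  have hφ : 0 < D.phic (rPrev x) := hD.phi₁_pos.trans_le (hD.phic_bounds _).1
  have hφa := hD.phia_pos
  have hc := chic_nonneg (D := D) ε x
  have ha := chia_nonneg (D := D) ε x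
  have hpos : 0 < D.chic ε x * D.phic (rPrev x) + D.chia ε x * D.phia := by
    rcases hχ with h | h <;> positivity
  have hmain := mul_pos (mul_pos hD.rhow_pos hpos) hS
  have hstep : -(D.Cphi * F) ≤ (D.phic (r x) - D.phic (rPrev x)) / h := by
    have h1 := hD.phic_lipschitz (r x) (rPrev x)
    rw [hr, add_sub_cancel_left, abs_of_nonneg (mul_nonneg hh.le hF0), ← hr] at h1
    rw [le_div_iff₀ hh]
    linarith [(abs_le.1 h1).1]
  have hdrop : -(D.Cphi * D.Cs * F) ≤ (D.phic (r x) - D.phic (rPrev x)) / h * D.S (p x) := by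
    have h1 := mul_le_mul_of_nonneg_right hstep (hD.S_bounds (p x)).1.le
    have h2 := mul_le_mul_of_nonneg_left (hD.S_bounds (p x)).2
      (mul_nonneg hD.Cphi_pos.le hF0)
    linarith
  have h1 := mul_le_mul_of_nonneg_left hdrop (mul_nonneg hD.rhow_pos.le hc)
  have h2 : 0 ≤ D.chic ε x * (-(D.alpha₁ + D.rhow * D.Cphi * D.Cs) * F) :=
    mul_nonneg hc (mul_nonneg (by linarith [hD.drying]) hF0)
  have e : D.residual ε h pPrev thPrev rPrev r p x
      = D.rhow * (D.chic ε x * D.phic (rPrev x) + D.chia ε x * D.phia)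
          * ((D.S (p x) - D.S (pPrev x)) / h)
        + D.rhow * D.chic ε x * ((D.phic (r x) - D.phic (rPrev x)) / h * D.S (p x))
        - D.alpha₁ * D.chic ε x * F := by
    rw [residual, ← hF]; ring
  linarith

/-- One time step preserves the bounds. The test function `-(pinf - p)⁺` gives the lower one; the
upper one comes from `(p - s)⁺` with every `s > 0`, for which the boundary integrand is integrable
because the trace is square integrable and exceeds `s` where the test function does not vanish. -/
theorem SolvesStep.bounds {Ω : Set Plane} {ε h : ℝ} {pPrev thPrev rPrev r p q : Plane → ℝ}
    (hs : D.SolvesStep Ω ε h pPrev thPrev rPrev r p q) (hD : D.Admissible)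
    (hΩo : IsOpen Ω) (hΩ : IsFiniteMeasure (volume.restrict Ω)) (hε : 0 < ε) (hh : 0 < h)
    (hpPrev : AEStronglyMeasurable pPrev (volume.restrict Ω))
    (hth : AEStronglyMeasurable thPrev (volume.restrict Ω))
    (hrPrev : AEStronglyMeasurable rPrev (volume.restrict Ω))
    (hr : AEStronglyMeasurable r (volume.restrict Ω))
    (hq : IsTrace Ω p q)
    (hrec : ∀ᵐ x ∂(volume.restrict Ω), r x = rPrev x + h * D.f (p x) (thPrev x) (rPrev x))
    (hPrev : ∀ᵐ x ∂(volume.restrict Ω), D.pinf ≤ pPrev x ∧ pPrev x ≤ 0) :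
    (∀ᵐ x ∂(volume.restrict Ω), D.pinf ≤ p x ∧ p x ≤ 0) ∧
      ∀ᵐ x ∂(surfaceMeasure Ω), D.pinf ≤ q x ∧ q x ≤ 0 := by
  have hp := hq.1.1.1
  have hχ := ae_restrict_of_ae (s := Ω) (ae_chic_pos_or_chia_pos hD hε)
  have hpinf := hD.pinf_neg
  have lower : (∀ᵐ x ∂(volume.restrict Ω), D.pinf ≤ p x) ∧
      ∀ᵐ x ∂(surfaceMeasure Ω), D.pinf ≤ q x := by
    obtain ⟨Φ, hΦ⟩ := exists_isTruncation_sub_max (s := -D.pinf) (by linarith)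
    obtain ⟨hζ, hG⟩ := hΦ.reflect.isTrace hΩo hq
    have hneg : ∀ {t : ℝ}, -max (-t - -D.pinf) 0 ≠ 0 →
        t < D.pinf ∧ -max (-t - -D.pinf) 0 = t - D.pinf := by
      intro t ht
      have hlt : t < D.pinf := by
        by_contra hle
        exact ht (by rw [max_eq_right (by linarith), neg_zero])
      exact ⟨hlt, by rw [max_eq_left (by linarith)]; ring⟩
    have hfin : ∀ {t : ℝ}, -max (-t - -D.pinf) 0 = 0 → D.pinf ≤ t := fun {t} ht => by
      have := le_max_left (-t - -D.pinf) 0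
      linarith
    refine (hs.ae_eq_zero hD hΩ hpPrev hth hrPrev hr hp hζ ?_ ?_ ?_ ?_).imp
      (fun h1 => h1.mono fun x => hfin) (fun h2 => h2.mono fun x => hfin)
    · filter_upwards [hχ, hrec, hPrev] with x hχx hrx hpx hne
      obtain ⟨hlt, he⟩ := hneg hne
      rw [he]
      exact mul_pos_of_neg_of_neg (residual_neg hD hh hχx hrx hpx.1 hlt) (by linarith)
    · filter_upwards [hG] with x hx
      rw [hx, inner_smul_right]
      exact mul_nonneg (by split_ifs <;> norm_num) real_inner_self_nonneg
    · intro x hne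
      obtain ⟨hlt, he⟩ := hneg hne
      rw [he]
      exact mul_pos_of_neg_of_neg (by linarith) (by linarith)
    · refine hζ.2.1.integrable_sq.congr (ae_of_all _ fun x => ?_)
      by_cases hne : -max (-q x - -D.pinf) 0 = 0
      · simp only [hne]; ring
      · simp only [(hneg hne).2]; ring
  have upper : ∀ s : ℝ, 0 < s → (∀ᵐ x ∂(volume.restrict Ω), p x ≤ s) ∧
      ∀ᵐ x ∂(surfaceMeasure Ω), q x ≤ s := by
    intro s hs0
    obtain ⟨Φ, hΦ⟩ := exists_isTruncation_sub_max hs0.le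
    obtain ⟨hζ, hG⟩ := hΦ.isTrace hΩo hq
    have hpos : ∀ {t : ℝ}, max (t - s) 0 ≠ 0 → s < t ∧ max (t - s) 0 = t - s := by
      intro t ht
      have hlt : s < t := by
        by_contra hle
        exact ht (max_eq_right (by linarith))
      exact ⟨hlt, max_eq_left (by linarith)⟩
    have hfin : ∀ {t : ℝ}, max (t - s) 0 = 0 → t ≤ s := fun {t} ht => by
      have := le_max_left (t - s) 0
      linarith
    refine (hs.ae_eq_zero hD hΩ hpPrev hth hrPrev hr hp hζ ?_ ?_ ?_ ?_).imp
      (fun h1 => h1.mono fun x => hfin) (fun h2 => h2.mono fun x => hfin)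
    · filter_upwards [hχ, hrec, hPrev] with x hχx hrx hpx hne
      obtain ⟨hlt, he⟩ := hpos hne
      rw [he]
      exact mul_pos (residual_pos hD hh hχx hrx (by linarith)) (by linarith)
    · filter_upwards [hG] with x hx
      rw [hx, inner_smul_right]
      exact mul_nonneg (by split_ifs <;> norm_num) real_inner_self_nonneg
    · intro x hne
      obtain ⟨hlt, he⟩ := hpos hne
      rw [he]
      exact mul_pos (by linarith) (by linarith)
    · refine (hq.2.1.integrable_sq.const_mul (1 + -D.pinf / s)).mono'
        ((hq.2.1.1.sub aestronglyMeasurable_const).mul hζ.2.1.1) (ae_of_all _ fun x => ?_)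
      have hc : 0 ≤ -D.pinf / s := div_nonneg (by linarith) hs0.le
      by_cases hne : max (q x - s) 0 = 0
      · simp only [hne, mul_zero, norm_zero]; positivity
      · obtain ⟨hlt, he⟩ := hpos hne
        have hq0 : 0 < q x := hs0.trans hlt
        have h3 : -D.pinf ≤ -D.pinf / s * q x := by
          rw [div_mul_eq_mul_div, le_div_iff₀ hs0]
          exact mul_le_mul_of_nonneg_left hlt.le (by linarith)
        rw [he, Real.norm_eq_abs, abs_of_pos (mul_pos (by linarith) (by linarith))]
        calc (q x - D.pinf) * (q x - s) ≤ ((1 + -D.pinf / s) * q x) * q x :=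
              mul_le_mul (by linarith) (by linarith) (by linarith) (by positivity)
          _ = (1 + -D.pinf / s) * q x ^ 2 := by ring
  have hzero : ∀ {μ : Measure Plane} {u : Plane → ℝ},
      (∀ s : ℝ, 0 < s → ∀ᵐ x ∂μ, u x ≤ s) → ∀ᵐ x ∂μ, u x ≤ 0 := by
    intro μ u hu
    filter_upwards [ae_all_iff.2 fun m : ℕ => hu (1 / ((m : ℝ) + 1)) (by positivity)] with x hx
    exact ge_of_tendsto' tendsto_one_div_add_atTop_nhds_zero_nat hx
  exact ⟨lower.1.and (hzero fun s hs0 => (upper s hs0).1),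
    lower.2.and (hzero fun s hs0 => (upper s hs0).2)⟩

end PressureData

end PorousMedium

theorem mainTheorem4 (D : PorousMedium.PressureData) (hD : D.Admissible)
    (Ω : Set PorousMedium.Plane) (hΩ : PorousMedium.IsLipschitzDomain Ω)
    (T ε : ℝ) (hT : 0 < T) (hε : 0 < ε) (n : ℕ) (hn : 1 ≤ n)
    (p₀ : PorousMedium.Plane → ℝ)
    (hp₀_mem : MemLp p₀ ⊤ (volume.restrict Ω))
    (hp₀ : ∀ᵐ x ∂(volume.restrict Ω), D.pinf < p₀ x ∧ p₀ x ≤ 0)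
    (p q th r : ℕ → PorousMedium.Plane → ℝ)
    -- initial pressure and integrability of the temperatures and memory functions
    (hp_init : p 0 =ᵐ[volume.restrict Ω] p₀)
    (hth : ∀ i ∈ Finset.range n, MemLp (th i) 1 (volume.restrict Ω))
    (hr_mem : ∀ i ∈ Finset.range (n + 1), MemLp (r i) 1 (volume.restrict Ω))
    -- the memory functions
    (hr_init : r 0 =ᵐ[volume.restrict Ω] 0)
    (hr : ∀ i ∈ Finset.Icc 1 n, ∀ᵐ x ∂(volume.restrict Ω),
      r i x = (T / n) * ∑ j ∈ Finset.Icc 1 i, D.f (p j x) (th (j - 1) x) (r (j - 1) x))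
    -- the pressures, with boundary traces `q i`, solve the discretized equation
    (hp_mem : ∀ i ∈ Finset.Icc 1 n, PorousMedium.MemW12 Ω (p i) ∧
      MemLp (p i) ⊤ (volume.restrict Ω))
    (hq : ∀ i ∈ Finset.Icc 1 n, PorousMedium.IsTrace Ω (p i) (q i))
    (hp_solves : ∀ i ∈ Finset.Icc 1 n,
      D.SolvesStep Ω ε (T / n) (p (i - 1)) (th (i - 1)) (r (i - 1)) (r i) (p i) (q i)) :
    ∀ i ∈ Finset.Icc 1 n,
      (∀ᵐ x ∂(volume.restrict Ω), D.pinf ≤ p i x ∧ p i x ≤ 0) ∧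
      (∀ᵐ x ∂(PorousMedium.surfaceMeasure Ω), D.pinf ≤ q i x ∧ q i x ≤ 0) := by
  have hn0 : (0 : ℝ) < n := by exact_mod_cast hn
  have hh : 0 < T / n := div_pos hT hn0
  have hfin : IsFiniteMeasure (volume.restrict Ω) :=
    ⟨by simpa using hΩ.isBounded.measure_lt_top⟩
  have hmeas : ∀ i ≤ n, AEStronglyMeasurable (p i) (volume.restrict Ω) := by
    intro i hi
    rcases Nat.eq_zero_or_pos i with rfl | hpos
    · exact hp₀_mem.1.congr hp_init.symm
    · exact (hp_mem i (Finset.mem_Icc.2 ⟨hpos, hi⟩)).1.1.1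
  have hrec : ∀ i < n, ∀ᵐ x ∂(volume.restrict Ω),
      r (i + 1) x = r i x + T / n * D.f (p (i + 1) x) (th i x) (r i x) := by
    intro i hi
    have hr0 : ∀ᵐ x ∂(volume.restrict Ω), r i x =
        (T / n) * ∑ j ∈ Finset.Icc 1 i, D.f (p j x) (th (j - 1) x) (r (j - 1) x) := by
      rcases Nat.eq_zero_or_pos i with rfl | hpos
      · filter_upwards [hr_init] with x hx
        simpa using hx
      · exact hr i (Finset.mem_Icc.2 ⟨hpos, hi.le⟩)
    filter_upwards [hr0, hr (i + 1) (Finset.mem_Icc.2 ⟨by omega, hi⟩)] with x h0 h1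
    rw [h1, Finset.sum_Icc_succ_top (by omega), mul_add, ← h0, Nat.add_sub_cancel]
  have hstep : ∀ i < n, (∀ᵐ x ∂(volume.restrict Ω), D.pinf ≤ p i x ∧ p i x ≤ 0) →
      (∀ᵐ x ∂(volume.restrict Ω), D.pinf ≤ p (i + 1) x ∧ p (i + 1) x ≤ 0) ∧
      ∀ᵐ x ∂(PorousMedium.surfaceMeasure Ω), D.pinf ≤ q (i + 1) x ∧ q (i + 1) x ≤ 0 := by
    intro i hi hPrev
    have hi' : i + 1 ∈ Finset.Icc 1 n := Finset.mem_Icc.2 ⟨by omega, hi⟩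
    exact (hp_solves (i + 1) hi').bounds hD hΩ.isOpen hfin hε hh (hmeas i hi.le)
      (hth i (Finset.mem_range.2 hi)).1 (hr_mem i (Finset.mem_range.2 (by omega))).1
      (hr_mem (i + 1) (Finset.mem_range.2 (by omega))).1 (hq (i + 1) hi') (hrec i hi) hPrev
  have hall : ∀ i ≤ n, ∀ᵐ x ∂(volume.restrict Ω), D.pinf ≤ p i x ∧ p i x ≤ 0 := by
    intro i
    induction i with
    | zero =>
      intro _
      filter_upwards [hp₀, hp_init] with x hx he
      rw [he]
      exact ⟨hx.1.le, hx.2⟩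
    | succ k ih => exact fun hk => (hstep k hk (ih (by omega))).1
  intro i hi
  obtain ⟨k, rfl⟩ := Nat.exists_eq_add_of_le' (Finset.mem_Icc.1 hi).1
  have hk := (Finset.mem_Icc.1 hi).2
  exact hstep k hk (hall k (by omega))
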